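/- Let $X$ be a $\delta$-disjoint metric space for some $\delta>0$, that is, $d(x,y)\ge\delta$ whenever $x\neq y$. For a family $\mathcal U$ of subsets of $X$ put $L_{\mathcal U}(x)=\sup_{U\in\mathcal U}\operatorname{dist}(x,X\setminus U)\in[0,\infty]$, where $\operatorname{dist}(x,\emptyset)=\infty$. The family is coarse if $L_{\mathcal U}(x)\to\infty$ as $x\to\infty$, i.e. for every $t$ the inequality $L_{\mathcal U}(x)>t$ holds for all $x$ outside a bounded set. A coarse refinement of $\mathcal U$ is a coarse family each of whose elements lies in an element of $\mathcal U$. The multiplicity of a family is the supremum over all points of the number of its elements containing the point. The coarse dimension of $X$ is the smallest integer $n\ge-1$ such that every finite coarse family in $X$ has a coarse refinement of multiplicity at most $n+1$ ($\infty$ if there is none). The covering dimension of a topological space is the smallest integer $n\ge-1$ such that every finite open cover has a finite open refinement that covers and has multiplicity at most $n+1$ ($\infty$ if there is none). For a cover $\mathcal W$ of a metric space $Z$, the Lebesgue number is $\inf_{z\in Z}L_{\mathcal W}(z)$, where $L_{\mathcal W}$ is defined as above with $Z$ in place of $X$. A function $f:X\to[0,\infty)$ is slowly oscillating if $f^{-1}(\mathcal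 W)$ is a coarse family for every cover $\mathcal W$ of $[0,\infty)$ of positive Lebesgue number. A Higson compactification of $X$ is a compact Hausdorff space $h(X)$ containing $X$ as a dense subspace such that a bounded continuous function $f:X\to[0,\infty)$ extends to a continuous function $h(X)\to[0,\infty)$ if and only if $f$ is slowly oscillating. Then, for every Higson compactification $h(X)$ of $X$: 1. if $X$ is unbounded or empty, the coarse dimension of $X$ equals the covering dimension of $h(X)$; 2. for arbitrary $X$ (bounded or not) and every integer $n\ge0$, the coarse dimension of $X$ is at most $n$ if and only if the covering dimension of $h(X)$ is at most $n$. (If $X$ is bounded and non-empty, the two dimensions are $-1$ and $0$, respectively.) -/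

import Mathlib

open scoped NNReal ENNReal

namespace CoarseGeometry

section Families

variable {X : Type*}

/-- `𝒱` refines `𝒰`: every element of `𝒱` is contained in an element of `𝒰`. -/
def Refines (𝒱 𝒰 : Set (Set X)) : Prop :=
  ∀ V ∈ 𝒱, ∃ U ∈ 𝒰, V ⊆ U

/-- The (global) multiplicity of a family of subsets: the supremum over all points `x` of the
number of elements of the family that contain `x`. -/
noncomputable def familyMultiplicity (𝒰 : Set (Set X)) : ℕ∞ :=
  ⨆ x : X, {U ∈ 𝒰 | x ∈ U}.encard

end Families

section Metric

variable {X Y : Type*} [MetricSpace X] [MetricSpace Y]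

/-- The local Lebesgue number `x ↦ sup {dist (x, X \ U) | U ∈ 𝒰}`, with values in `[0, ∞]`.
The distance to the empty set is `∞`, so it equals `∞` everywhere if `X ∈ 𝒰`. -/
noncomputable def localLebesgueNumber (𝒰 : Set (Set X)) (x : X) : ℝ≥0∞ :=
  ⨆ U ∈ 𝒰, Metric.infEDist x Uᶜ

/-- The Lebesgue number of `𝒰` on a subset `A`. -/
noncomputable def lebesgueNumber (𝒰 : Set (Set X)) (A : Set X) : ℝ≥0∞ :=
  ⨅ x ∈ A, localLebesgueNumber 𝒰 x

/-- A family of subsets is coarse if its local Lebesgue number is coarsely proper, that is,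
tends to infinity as the point tends to infinity (leaves every bounded set). -/
def IsCoarseFamily (𝒰 : Set (Set X)) : Prop :=
  Filter.Tendsto (localLebesgueNumber 𝒰) (Bornology.cobounded X) (nhds ∞)

variable (X) in
/-- The coarse dimension: the smallest integer `n = k - 1` such that every finite coarse family
in `X` has a coarse refinement of multiplicity at most `n + 1 = k`; it is `∞` if there is no
such `n`. Multiplicities are nonnegative, so the values are `-1, 0, 1, …, ∞`. -/
noncomputable def coarseDim : EReal :=
  ⨅ (k : ℕ) (_ : ∀ 𝒰 : Set (Set X), 𝒰.Finite → IsCoarseFamily 𝒰 →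
    ∃ 𝒱 : Set (Set X), IsCoarseFamily 𝒱 ∧ Refines 𝒱 𝒰 ∧ familyMultiplicity 𝒱 ≤ k),
    ((k : EReal) - 1)

/-- A function is slowly oscillating if the preimage of every cover of positive Lebesgue number
is a coarse family. -/
def IsSlowlyOscillating (f : X → Y) : Prop :=
  ∀ 𝒰 : Set (Set Y), ⋃₀ 𝒰 = Set.univ → 0 < lebesgueNumber 𝒰 Set.univ →
    IsCoarseFamily ((fun U => f ⁻¹' U) '' 𝒰)

variable (X) in
/-- A metric space is `δ`-disjoint if distinct points are at distance at least `δ`. -/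
def IsDisjointSpace (δ : ℝ) : Prop :=
  ∀ x y : X, x ≠ y → δ ≤ dist x y

end Metric

/-- The covering dimension of a topological space: the smallest integer `n = k - 1` such that
every finite open cover has a finite open refinement that is a cover and has multiplicity at
most `n + 1 = k`; it is `∞` if there is no such `n`. The empty space has dimension `-1`. -/
noncomputable def coveringDim (Y : Type*) [TopologicalSpace Y] : EReal :=
  ⨅ (k : ℕ) (_ : ∀ 𝒰 : Set (Set Y), 𝒰.Finite → (∀ U ∈ 𝒰, IsOpen U) → ⋃₀ 𝒰 = Set.univ →
    ∃ 𝒱 : Set (Set Y), 𝒱.Finite ∧ (∀ V ∈ 𝒱, IsOpen V) ∧ ⋃₀ 𝒱 = Set.univ ∧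
      Refines 𝒱 𝒰 ∧ familyMultiplicity 𝒱 ≤ k),
    ((k : EReal) - 1)

/-- `e : X → Y` exhibits `Y` as the Higson compactification of the metric space `X`: the space
`Y` is compact Hausdorff, it contains `X` (through `e`) as a dense subspace, and a bounded
continuous function `f : X → [0, ∞)` extends continuously over `Y` if and only if `f` is
slowly oscillating. -/
structure IsHigsonCompactification {X Y : Type*} [MetricSpace X] [TopologicalSpace Y]
    (e : X → Y) : Prop where
  compactSpace : CompactSpace Y
  t2Space : T2Space Y
  isDenseEmbedding : IsDenseEmbedding e
  extends_iff : ∀ f : BoundedContinuousFunction X ℝ≥0,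
    (∃ F : Y → ℝ≥0, Continuous F ∧ ∀ x, F (e x) = f x) ↔ IsSlowlyOscillating f

section Existence

variable {X : Type*} [MetricSpace X]

/-- Pairs of points at distance less than `M` whose first point tends to infinity. -/
def closePairs (X : Type*) [MetricSpace X] (M : ℝ) : Filter (X × X) :=
  Filter.comap Prod.fst (Bornology.cobounded X) ⊓ Filter.principal {p | dist p.1 p.2 < M}

lemma isSlowlyOscillating_iff {Y : Type*} [MetricSpace Y] (f : X → Y) :
    IsSlowlyOscillating f ↔
      ∀ M : ℝ, 0 < M → ∀ ε : ℝ, 0 < ε → ∀ᶠ x in Bornology.cobounded X,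
        ∀ y, dist x y < M → dist (f x) (f y) < ε := by
  constructor
  · intro h M hM ε hε
    have h1 := h (Set.range fun z : Y => Metric.ball z (ε / 2)) (by
        refine Set.eq_univ_of_forall fun z => ?_
        exact ⟨_, ⟨z, rfl⟩, Metric.mem_ball_self (by positivity)⟩) (by
        refine lt_of_lt_of_le (b := ENNReal.ofReal (ε / 2)) (by simpa using hε) ?_
        refine le_iInf₂ fun z _ => ?_
        refine le_trans ?_ (le_iSup₂ (f := fun U _ => Metric.infEDist z Uᶜ)
          (Metric.ball z (ε / 2)) ⟨z, rfl⟩)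
        refine Metric.le_infEDist.2 fun w hw => ?_
        rw [edist_dist]
        refine ENNReal.ofReal_le_ofReal ?_
        simpa [dist_comm] using hw)
    have h2 := (ENNReal.tendsto_nhds_top_iff_nnreal.1 h1) M.toNNReal
    filter_upwards [h2] with x hx y hy
    simp only [localLebesgueNumber, Set.mem_image, Set.mem_range, exists_exists_eq_and,
      lt_iSup_iff] at hx
    obtain ⟨_, ⟨z, rfl⟩, hz⟩ := hx
    have key : ∀ w, dist x w < M → f w ∈ Metric.ball z (ε / 2) := by
      intro w hw
      by_contra hcon
      have h3 : Metric.infEDist x (f ⁻¹' Metric.ball z (ε / 2))ᶜ ≤ edist x w :=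
        Metric.infEDist_le_edist_of_mem hcon
      rw [edist_dist] at h3
      have h4 := hz.trans_le (h3.trans (ENNReal.ofReal_le_ofReal hw.le))
      exact lt_irrefl _ h4
    have hfx := key x (by simpa using hM)
    have hfy := key y hy
    rw [Metric.mem_ball] at hfx hfy
    have := dist_triangle_right (f x) (f y) z
    linarith
  · intro h 𝒰 _ hpos
    refine ENNReal.tendsto_nhds_top_iff_nnreal.2 fun M => ?_
    obtain ⟨ε, hε0, hε⟩ := ENNReal.lt_iff_exists_nnreal_btwn.1 hpos
    filter_upwards [h (M + 1) (by positivity) ε (by exact_mod_cast hε0)] with x hx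
    have h1 : (ε : ℝ≥0∞) < localLebesgueNumber 𝒰 (f x) :=
      hε.trans_le (iInf₂_le (f x) (Set.mem_univ _))
    simp only [localLebesgueNumber, lt_iSup_iff] at h1
    obtain ⟨U, hU, hUε⟩ := h1
    refine lt_of_lt_of_le (b := ((M + 1 : ℝ≥0) : ℝ≥0∞)) (by
      exact_mod_cast lt_add_one M) ?_
    refine le_trans ?_ (le_iSup₂ (f := fun U _ => Metric.infEDist x Uᶜ)
      (f ⁻¹' U) ⟨U, hU, rfl⟩)
    refine Metric.le_infEDist.2 fun y hy => ?_
    by_contra hcon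
    rw [not_le, edist_nndist, ENNReal.coe_lt_coe] at hcon
    have h2 := hx y (by exact_mod_cast hcon)
    have h3 : Metric.infEDist (f x) Uᶜ ≤ edist (f x) (f y) :=
      Metric.infEDist_le_edist_of_mem hy
    have h4 := hUε.trans_le h3
    rw [edist_nndist, ENNReal.coe_lt_coe] at h4
    have h5 : (ε : ℝ) < dist (f x) (f y) := by exact_mod_cast h4
    linarith

lemma isSlowlyOscillating_iff_tendsto {Y : Type*} [MetricSpace Y] (f : X → Y) :
    IsSlowlyOscillating f ↔ ∀ M : ℝ, 0 < M →
      Filter.Tendsto (fun p : X × X => (f p.1, f p.2)) (closePairs X M) (uniformity Y) := by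
  rw [isSlowlyOscillating_iff]
  refine forall₂_congr fun M _ => ?_
  rw [Metric.uniformity_basis_dist.tendsto_right_iff]
  refine forall₂_congr fun ε _ => ?_
  rw [closePairs, Filter.eventually_inf_principal, Filter.eventually_comap]
  simp only [Prod.forall]
  refine Filter.eventually_congr (Filter.Eventually.of_forall fun x => ?_)
  constructor
  · rintro h a b rfl hab
    exact h b hab
  · intro h y hy
    exact h x y rfl hy

/-- Bounded continuous slowly oscillating functions to `[0, ∞)`. -/
def HigsonFun (X : Type*) [MetricSpace X] : Type _ :=
  {f : BoundedContinuousFunction X ℝ≥0 // IsSlowlyOscillating f}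

/-- The evaluation map of `X` into the product over all Higson functions. -/
def higsonEval (X : Type*) [MetricSpace X] (x : X) : HigsonFun X → ℝ≥0 :=
  fun f => f.1 x

/-- A concrete model of the Higson compactification. -/
abbrev HigsonSpace (X : Type*) [MetricSpace X] : Type _ :=
  closure (Set.range (higsonEval X))

/-- The inclusion of `X` in the concrete model. -/
def toHigsonSpace (X : Type*) [MetricSpace X] (x : X) : HigsonSpace X :=
  ⟨higsonEval X x, subset_closure ⟨x, rfl⟩⟩

instance (X : Type*) [MetricSpace X] : CompactSpace (HigsonSpace X) := by
  refine isCompact_iff_compactSpace.1 ?_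
  refine IsCompact.of_isClosed_subset (isCompact_univ_pi (s := fun f : HigsonFun X =>
    closure (Set.range f.1)) fun f => f.1.isBounded_range.isCompact_closure)
    isClosed_closure ?_
  refine closure_minimal ?_ (isClosed_set_pi fun _ _ => isClosed_closure)
  rintro _ ⟨x, rfl⟩ f -
  exact subset_closure ⟨x, rfl⟩

/-- A bump function of bounded support. -/
noncomputable def bump (a : X) (r : ℝ) : BoundedContinuousFunction X ℝ≥0 :=
  BoundedContinuousFunction.mkOfBound
    ⟨fun x => Real.toNNReal (r - dist x a), by fun_prop⟩ r.toNNReal (by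
      intro x y
      have h : ∀ z : X, Real.toNNReal (r - dist z a) ≤ r.toNNReal := fun z =>
        Real.toNNReal_le_toNNReal (by linarith [dist_nonneg (x := z) (y := a)])
      have hx : ((Real.toNNReal (r - dist x a) : ℝ≥0) : ℝ) ≤ (r.toNNReal : ℝ) := h x
      have hy : ((Real.toNNReal (r - dist y a) : ℝ≥0) : ℝ) ≤ (r.toNNReal : ℝ) := h y
      have hx0 := (Real.toNNReal (r - dist x a)).2
      have hy0 := (Real.toNNReal (r - dist y a)).2
      simp only [ContinuousMap.coe_mk, NNReal.dist_eq]
      rw [abs_le]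
      constructor <;> linarith [hx, hy, NNReal.coe_nonneg (Real.toNNReal (r - dist x a)),
        NNReal.coe_nonneg (Real.toNNReal (r - dist y a))])

lemma bump_apply (a : X) (r : ℝ) (x : X) : bump a r x = Real.toNNReal (r - dist x a) := rfl

lemma isSlowlyOscillating_bump (a : X) (r : ℝ) : IsSlowlyOscillating (bump a r) := by
  rw [isSlowlyOscillating_iff]
  intro M hM ε hε
  have h : (Metric.closedBall a (r + M))ᶜ ∈ Bornology.cobounded X :=
    Bornology.isBounded_def.1 Metric.isBounded_closedBall
  filter_upwards [h] with x hx y hy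
  rw [Set.mem_compl_iff, Metric.mem_closedBall, not_le] at hx
  have h1 : r - dist x a ≤ 0 := by linarith
  have h2 : r - dist y a ≤ 0 := by linarith [dist_triangle x y a]
  rw [bump_apply, bump_apply, Real.toNNReal_of_nonpos h1, Real.toNNReal_of_nonpos h2]
  simpa using hε

/-- Every metric space has a Higson compactification. -/
theorem isHigsonCompactification_toHigsonSpace (X : Type*) [MetricSpace X] :
    IsHigsonCompactification (toHigsonSpace X) where
  compactSpace := inferInstance
  t2Space := inferInstance
  isDenseEmbedding := by
    have hcont : Continuous (toHigsonSpace X) :=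
      Continuous.subtype_mk (continuous_pi fun f => f.1.continuous) _
    have hev : ∀ f : HigsonFun X, Continuous fun z : HigsonSpace X => z.1 f := fun f =>
      (continuous_apply f).comp continuous_subtype_val
    have hind : Topology.IsInducing (toHigsonSpace X) := by
      rw [Topology.isInducing_iff_nhds]
      intro a
      refine le_antisymm (Filter.map_le_iff_le_comap.1 (hcont.tendsto a)) ?_
      rw [Metric.nhds_basis_ball.ge_iff]
      intro r hr
      refine ⟨{z : HigsonSpace X | 0 < z.1 ⟨bump a r, isSlowlyOscillating_bump a r⟩},
        (isOpen_lt continuous_const (hev _)).mem_nhds ?_, ?_⟩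
      · change 0 < Real.toNNReal (r - dist a a)
        simpa using hr
      · intro x hx
        change 0 < Real.toNNReal (r - dist x a) at hx
        simpa using hx
    refine ⟨⟨hind, ?_⟩, hind.injective⟩
    intro z
    rw [closure_subtype]
    have himg : Subtype.val '' Set.range (toHigsonSpace X) = Set.range (higsonEval X) := by
      rw [← Set.range_comp]; rfl
    exact (Set.ext_iff.1 (congrArg closure himg) z.1).2 z.2
  extends_iff := by
    intro f
    constructor
    · rintro ⟨F, hF, hFf⟩
      rw [isSlowlyOscillating_iff_tendsto]
      intro M hM
      have hu := CompactSpace.uniformContinuous_of_continuous hF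
      have ht : Filter.Tendsto
          (fun p : X × X => (toHigsonSpace X p.1, toHigsonSpace X p.2)) (closePairs X M)
          (uniformity (HigsonSpace X)) := by
        rw [uniformity_subtype, Filter.tendsto_comap_iff, Pi.uniformity,
          Filter.tendsto_iInf]
        intro g
        rw [Filter.tendsto_comap_iff]
        exact (isSlowlyOscillating_iff_tendsto _).1 g.2 M hM
      have := Filter.Tendsto.comp hu ht
      refine this.congr fun p => ?_
      simp [hFf]
    · intro hf
      exact ⟨fun z => z.1 ⟨f, hf⟩, (continuous_apply _).comp continuous_subtype_val,
        fun x => rfl⟩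

end Existence

end CoarseGeometry

/-! Finite open covers of `h(X)` and finite coarse covers of `X` determine each other. Restricting
an open cover to `X` gives a coarse family: Urysohn functions of a shrinking are slowly oscillating
on `X` (`isCoarseFamily_preimage`). Conversely, the normalized distance functions of a coarse cover
form a slowly oscillating partition of unity; it extends to `h(X)`, so the open extensions of the
members cover `h(X)` (`iUnion_openExtension`). Here `δ`-disjointness keeps the denominator positive
at every point, not only far out. Density of `X` prevents open extension from raising multiplicity.

A coarse family may miss a bounded set `B`. Removing `B` from sets is harmless for coarseness;
covering `B` again requires multiplicity at least 1. Hence only multiplicity 0, that is dimension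
-1, can tell the two dimensions apart. -/

namespace CoarseGeometry

open Filter Bornology Set

/-! ### Open extensions of subsets along a dense map. -/

section

variable {X Y : Type*} [TopologicalSpace Y]

/-- The largest open subset of `Y` whose trace on `X` is contained in `A`. -/
def openExtension (e : X → Y) (A : Set X) : Set Y := (closure (e '' Aᶜ))ᶜ

lemma isOpen_openExtension (e : X → Y) (A : Set X) : IsOpen (openExtension e A) :=
  isClosed_closure.isOpen_compl

lemma preimage_openExtension_subset (e : X → Y) (A : Set X) :
    e ⁻¹' openExtension e A ⊆ A := by
  intro x hx
  by_contra h
  exact hx (subset_closure ⟨x, h, rfl⟩)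

lemma openExtension_subset_closure {e : X → Y} (he : DenseRange e) (A : Set X) :
    openExtension e A ⊆ closure (e '' A) := by
  intro y hy
  have h : y ∈ closure (e '' A ∪ e '' Aᶜ) := by
    rw [← image_union, union_compl_self, image_univ]
    exact he y
  rw [closure_union] at h
  exact h.resolve_right hy

/-- The extensions containing `y` have open, nonempty intersection, so some `e x` lies in all of
them. Indices are counted because distinct indices may give equal sets. -/
lemma encard_mem_openExtension_le {e : X → Y} (he : DenseRange e) {ι : Type*} [Finite ι]
    {W : ι → Set X} {k : ℕ∞} (h : ∀ x, {i | x ∈ W i}.encard ≤ k) (y : Y) :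
    {i | y ∈ openExtension e (W i)}.encard ≤ k := by
  set T := {i | y ∈ openExtension e (W i)} with hT
  have ho : IsOpen (⋂ i ∈ T, openExtension e (W i)) :=
    T.toFinite.isOpen_biInter fun i _ => isOpen_openExtension e (W i)
  obtain ⟨x, hx⟩ := he.exists_mem_open ho ⟨y, mem_iInter₂.2 fun i hi => hi⟩
  refine (encard_le_encard fun i hi => ?_).trans (h x)
  exact preimage_openExtension_subset e (W i) (mem_iInter₂.1 hx i hi)

end

/-! ### Coarse families and slowly oscillating quotients. -/

section

variable {X : Type*} [MetricSpace X]

/-- A family is coarse if and only if, for every radius, the balls of this radius about points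
outside a bounded set lie in elements of the family. -/
lemma isCoarseFamily_iff_ball_subset (𝒰 : Set (Set X)) :
    IsCoarseFamily 𝒰 ↔
      ∀ M : ℝ, 0 < M → ∀ᶠ x in cobounded X, ∃ U ∈ 𝒰, Metric.ball x M ⊆ U := by
  rw [IsCoarseFamily, ENNReal.tendsto_nhds_top_iff_nnreal]
  constructor
  · intro h M hM
    filter_upwards [h M.toNNReal] with x hx
    simp only [localLebesgueNumber, lt_iSup_iff] at hx
    obtain ⟨U, hU, hx⟩ := hx
    refine ⟨U, hU, fun y hy => ?_⟩
    by_contra hcon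
    have h3 : Metric.infEDist x Uᶜ ≤ edist x y := Metric.infEDist_le_edist_of_mem hcon
    rw [edist_dist] at h3
    rw [Metric.mem_ball'] at hy
    exact lt_irrefl _ (hx.trans_le (h3.trans (ENNReal.ofReal_le_ofReal hy.le)))
  · intro h M
    filter_upwards [h (M + 1) (by positivity)] with x hx
    obtain ⟨U, hU, hx⟩ := hx
    refine lt_of_lt_of_le (b := ((M + 1 : ℝ≥0) : ℝ≥0∞)) (by
      exact_mod_cast lt_add_one M) ?_
    refine le_trans ?_ (le_iSup₂ (f := fun U _ => Metric.infEDist x Uᶜ) U hU)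
    refine Metric.le_infEDist.2 fun y hy => ?_
    by_contra hcon
    rw [not_le, edist_nndist, ENNReal.coe_lt_coe] at hcon
    refine hy (hx ?_)
    rw [Metric.mem_ball']
    exact_mod_cast hcon

/-- Balls of a given radius about points far away avoid a given bounded set. -/
lemma eventually_disjoint_ball {B : Set X} (hB : IsBounded B) (M : ℝ) :
    ∀ᶠ x in cobounded X, Disjoint (Metric.ball x M) B := by
  have h : (Metric.cthickening M B)ᶜ ∈ cobounded X := isBounded_def.1 hB.cthickening
  filter_upwards [h] with x hx
  refine Set.disjoint_left.2 fun y hy hyB => hx ?_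
  exact Metric.mem_cthickening_of_dist_le x y M B hyB (Metric.mem_ball'.1 hy).le

lemma familyMultiplicity_range_le {Z ι : Type*} {W : ι → Set Z} {k : ℕ∞}
    (h : ∀ z, {i | z ∈ W i}.encard ≤ k) : familyMultiplicity (range W) ≤ k := by
  refine iSup_le fun z => le_trans ?_ (h z)
  refine le_trans (encard_le_encard ?_) (encard_image_le W _)
  rintro _ ⟨⟨i, rfl⟩, hz⟩
  exact ⟨i, hz, rfl⟩

/-- Normalized distance functions of a finite coarse cover are slowly oscillating. -/
lemma isSlowlyOscillating_infDist_div_sum {ι : Type*} [Fintype ι] {W : ι → Set X}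
    (hW : IsCoarseFamily (range W)) (hne : ∀ i, (W i)ᶜ.Nonempty)
    (hpos : ∀ x, 0 < ∑ j, Metric.infDist x (W j)ᶜ) (i : ι) :
    IsSlowlyOscillating
      (fun x => Metric.infDist x (W i)ᶜ / ∑ j, Metric.infDist x (W j)ᶜ) := by
  rw [isSlowlyOscillating_iff]
  intro M hM ε hε
  set n : ℝ := (Fintype.card ι : ℝ) with hn
  have hn0 : 0 ≤ n := Nat.cast_nonneg _
  set f : ι → X → ℝ := fun i x => Metric.infDist x (W i)ᶜ with hf
  have hlip : ∀ j x y, |f j x - f j y| ≤ dist x y := fun j x y =>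
    abs_sub_le_iff.2 ⟨by linarith [Metric.infDist_le_infDist_add_dist (s := (W j)ᶜ) (x := x) (y := y)],
      by linarith [Metric.infDist_le_infDist_add_dist (s := (W j)ᶜ) (x := y) (y := x),
        dist_comm x y]⟩
  have hf0 : ∀ j x, 0 ≤ f j x := fun j x => Metric.infDist_nonneg
  -- The numerator in `hid` below is at most `(n + 1) * M`, so `S x > (n + 1) * M / ε` suffices; the
  -- extra `1` gives strictness.
  filter_upwards [(isCoarseFamily_iff_ball_subset _).1 hW ((n + 1) * M / ε + 1) (by positivity)]
    with x hx y hxy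
  obtain ⟨_, ⟨l, rfl⟩, hl⟩ := hx
  set S : X → ℝ := fun x => ∑ j, f j x with hS
  have hSx : (n + 1) * M / ε < S x := by
    have h1 : (n + 1) * M / ε + 1 ≤ f l x := by
      refine (Metric.le_infDist (hne l)).2 fun z hz => ?_
      by_contra hcon
      exact hz (hl (Metric.mem_ball'.2 (not_le.1 hcon)))
    have h2 : f l x ≤ S x :=
      Finset.single_le_sum (f := fun j => f j x) (fun j _ => hf0 j x) (Finset.mem_univ l)
    linarith
  have hx0 : 0 < S x := hpos x
  have hy0 : 0 < S y := hpos y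
  have hSS : |S y - S x| ≤ n * M := by
    have : S y - S x = ∑ j, (f j y - f j x) := by simp [hS]
    rw [this]
    refine (Finset.abs_sum_le_sum_abs _ _).trans ?_
    refine (Finset.sum_le_card_nsmul _ _ M fun j _ => ?_).trans ?_
    · exact (hlip j y x).trans (by rw [dist_comm]; exact hxy.le)
    · simp [hn]
  have hq : |f i y / S y| ≤ 1 := by
    rw [abs_of_nonneg (div_nonneg (hf0 i y) hy0.le), div_le_one hy0]
    exact Finset.single_le_sum (f := fun j => f j y) (fun j _ => hf0 j y) (Finset.mem_univ i)
  have hid : f i x / S x - f i y / S y =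
      ((f i x - f i y) + f i y / S y * (S y - S x)) / S x := by
    field_simp
    ring
  change |f i x / S x - f i y / S y| < ε
  rw [hid, abs_div, abs_of_pos hx0, div_lt_iff₀ hx0]
  rw [div_lt_iff₀ hε] at hSx
  have h1 : |f i y / S y * (S y - S x)| ≤ 1 * (n * M) := by
    rw [abs_mul]
    exact mul_le_mul hq hSS (abs_nonneg _) zero_le_one
  have h2 := abs_add_le (f i x - f i y) (f i y / S y * (S y - S x))
  have h3 := hlip i x y
  nlinarith

/-! ### Passing between covers of `X` and of its Higson compactification. -/

variable {Y : Type*} [TopologicalSpace Y]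

/-- A finite open cover of the Higson compactification restricts to a coarse family. -/
lemma IsHigsonCompactification.isCoarseFamily_preimage {e : X → Y}
    (he : IsHigsonCompactification e) {ι : Type*} [Finite ι] {U : ι → Set Y}
    (hU : ∀ i, IsOpen (U i)) (hcov : ⋃ i, U i = univ) :
    IsCoarseFamily (range fun i => e ⁻¹' U i) := by
  have := he.compactSpace
  have := he.t2Space
  obtain ⟨K, hKcov, -, hKU⟩ :=
    exists_iUnion_eq_closure_subset hU (fun _ => Set.toFinite _) hcov
  have hF : ∀ i, ∃ F : C(Y, ℝ≥0), EqOn F 0 (U i)ᶜ ∧ EqOn F 1 (closure (K i)) := by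
    intro i
    obtain ⟨F, h0, h1, -⟩ := exists_continuous_zero_one_of_isClosed (hU i).isClosed_compl
      (isClosed_closure (s := K i)) (disjoint_left.2 fun y hy hyK => hy (hKU i hyK))
    exact ⟨⟨fun y => (F y).toNNReal, by fun_prop⟩, fun y hy => by simp [h0 hy],
      fun y hy => by simp [h1 hy]⟩
  choose F h0 h1 using hF
  have hso : ∀ i, IsSlowlyOscillating fun x => F i (e x) := fun i =>
    (he.extends_iff ((BoundedContinuousFunction.mkOfCompact (F i)).compContinuous
      ⟨e, he.isDenseEmbedding.continuous⟩)).1 ⟨F i, (F i).continuous, fun x => rfl⟩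
  rw [isCoarseFamily_iff_ball_subset]
  intro M hM
  -- `F i` is 1 on `K i` and 0 off `U i`, so oscillation below 1 keeps the ball about a point of `K
  -- i` inside `U i`.
  have hev := eventually_all.2 fun i => (isSlowlyOscillating_iff _).1 (hso i) M hM 1 one_pos
  filter_upwards [hev] with x hx
  obtain ⟨i, hi⟩ := mem_iUnion.1 (hKcov.symm ▸ mem_univ (e x))
  refine ⟨_, ⟨i, rfl⟩, fun y hy => ?_⟩
  by_contra hcon
  have h := hx i y (Metric.mem_ball'.1 hy)
  rw [h0 i hcon, h1 i (subset_closure hi)] at h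
  simp [NNReal.dist_eq] at h

/-- A finite coarse cover of a uniformly discrete space extends to an open cover of the Higson
compactification. -/
lemma IsHigsonCompactification.iUnion_openExtension {e : X → Y}
    (he : IsHigsonCompactification e) {δ : ℝ} (hδ : 0 < δ) (hX : IsDisjointSpace X δ)
    {ι : Type*} [Finite ι] {W : ι → Set X} (hW : IsCoarseFamily (range W))
    (hcov : ⋃ i, W i = univ) : ⋃ i, openExtension e (W i) = univ := by
  cases nonempty_fintype ι
  have hdense : DenseRange e := he.isDenseEmbedding.dense
  -- `Metric.infDist` to the empty set is 0 by default, so a member equal to `X` is treated apart;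
  -- its open extension is all of `Y`.
  by_cases hne : ∀ i, (W i)ᶜ.Nonempty
  swap
  · push Not at hne
    obtain ⟨i, hi⟩ := hne
    refine eq_univ_of_forall fun y => mem_iUnion.2 ⟨i, ?_⟩
    simp [openExtension, hi]
  set S : X → ℝ := fun x => ∑ j, Metric.infDist x (W j)ᶜ with hS
  have hpos : ∀ x, 0 < S x := by
    intro x
    obtain ⟨i, hi⟩ := mem_iUnion.1 (hcov.symm ▸ mem_univ x)
    refine Finset.sum_pos' (fun j _ => Metric.infDist_nonneg) ⟨i, Finset.mem_univ i, ?_⟩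
    refine hδ.trans_le ((Metric.le_infDist (hne i)).2 fun z hz => hX x z ?_)
    rintro rfl
    exact hz hi
  set g : ι → X → ℝ := fun i x => Metric.infDist x (W i)ᶜ / S x with hg
  have hg0 : ∀ i x, 0 ≤ g i x := fun i x => div_nonneg Metric.infDist_nonneg (hpos x).le
  have hgsum : ∀ x, ∑ i, g i x = 1 := fun x => by
    rw [hg, ← Finset.sum_div, div_self (hpos x).ne']
  have hg1 : ∀ i x, g i x ≤ 1 := fun i x => by
    rw [← hgsum x]
    exact Finset.single_le_sum (f := fun j => g j x) (fun j _ => hg0 j x) (Finset.mem_univ i)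
  have hgc : ∀ i, Continuous (g i) := fun i =>
    (Metric.continuous_infDist_pt _).div
      (continuous_finsetSum _ fun j _ => Metric.continuous_infDist_pt _) fun x => (hpos x).ne'
  have hG : ∀ i, ∃ G : Y → ℝ≥0, Continuous G ∧ ∀ x, (G (e x) : ℝ) = g i x := by
    intro i
    have hso := (isSlowlyOscillating_iff _).1 (isSlowlyOscillating_infDist_div_sum hW hne hpos i)
    obtain ⟨G, hGc, hGe⟩ := (he.extends_iff (BoundedContinuousFunction.mkOfBound
      ⟨fun x => ⟨g i x, hg0 i x⟩, (hgc i).subtype_mk _⟩ 1 fun x y => by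
        change |g i x - g i y| ≤ 1
        rw [abs_le]
        constructor <;> linarith [hg0 i x, hg0 i y, hg1 i x, hg1 i y])).2
      ((isSlowlyOscillating_iff _).2 fun M hM ε hε => hso M hM ε hε)
    exact ⟨G, hGc, fun x => by rw [hGe]; rfl⟩
  choose G hGc hGe using hG
  have hsum : (fun y => ∑ i, G i y) = fun _ => 1 := by
    refine hdense.equalizer (continuous_finsetSum _ fun i _ => hGc i) continuous_const ?_
    funext x
    refine NNReal.coe_injective ?_
    simp only [Function.comp, NNReal.coe_sum, hGe, NNReal.coe_one, hgsum]
  refine eq_univ_of_forall fun y => ?_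
  -- A point outside every extension is in the closure of every `e '' (W i)ᶜ`, where `G i` vanishes,
  -- against the sum being 1.
  by_contra hy
  rw [mem_iUnion, not_exists] at hy
  have hzero : ∀ i, G i y = 0 := by
    intro i
    have hyi : y ∈ closure (e '' (W i)ᶜ) := not_not.1 (hy i)
    refine closure_minimal (t := {z | G i z = 0}) ?_ (isClosed_eq (hGc i) continuous_const) hyi
    rintro _ ⟨x, hx, rfl⟩
    refine NNReal.coe_injective ?_
    rw [hGe, hg]
    simp [Metric.infDist_zero_of_mem hx]
  have h1 := congrFun hsum y
  simp [hzero] at h1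

/-! ### Comparison of the two dimensions. -/

variable (X) in
/-- The coarse dimension of `X` is less than `k`. -/
def CoarseDimLT (k : ℕ) : Prop :=
  ∀ 𝒰 : Set (Set X), 𝒰.Finite → IsCoarseFamily 𝒰 →
    ∃ 𝒱 : Set (Set X), IsCoarseFamily 𝒱 ∧ Refines 𝒱 𝒰 ∧ familyMultiplicity 𝒱 ≤ k

variable (Y) in
/-- The covering dimension of `Y` is less than `k`. -/
def CoveringDimLT (k : ℕ) : Prop :=
  ∀ 𝒰 : Set (Set Y), 𝒰.Finite → (∀ U ∈ 𝒰, IsOpen U) → ⋃₀ 𝒰 = Set.univ →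
    ∃ 𝒱 : Set (Set Y), 𝒱.Finite ∧ (∀ V ∈ 𝒱, IsOpen V) ∧ ⋃₀ 𝒱 = Set.univ ∧
      Refines 𝒱 𝒰 ∧ familyMultiplicity 𝒱 ≤ k

lemma CoarseDimLT.mono {k l : ℕ} (h : CoarseDimLT X k) (hkl : k ≤ l) : CoarseDimLT X l := by
  intro 𝒰 hf hc
  obtain ⟨𝒱, h1, h2, h3⟩ := h 𝒰 hf hc
  exact ⟨𝒱, h1, h2, h3.trans (by exact_mod_cast hkl)⟩

lemma CoveringDimLT.mono {k l : ℕ} (h : CoveringDimLT Y k) (hkl : k ≤ l) :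
    CoveringDimLT Y l := by
  intro 𝒰 hf ho hc
  obtain ⟨𝒱, h1, h2, h3, h4, h5⟩ := h 𝒰 hf ho hc
  exact ⟨𝒱, h1, h2, h3, h4, h5.trans (by exact_mod_cast hkl)⟩

/-- If `P (n + 1)` fails, monotonicity forces every admissible `k` to be at least `n + 2`, so the
infimum is at least `n + 1`. -/
lemma iInf_natCast_sub_one_le_iff {P : ℕ → Prop} (hP : ∀ k l, k ≤ l → P k → P l) (n : ℕ) :
    (⨅ (k : ℕ) (_ : P k), ((k : EReal) - 1)) ≤ (n : EReal) ↔ P (n + 1) := by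
  have hsub : ∀ m : ℕ, ((m + 1 : ℕ) : EReal) - 1 = m := fun m => by
    rw [Nat.cast_add, Nat.cast_one]
    exact EReal.add_sub_cancel_right (b := 1)
  constructor
  · intro h
    by_contra hn
    have h1 : ((n + 1 : ℕ) : EReal) ≤ ⨅ (k : ℕ) (_ : P k), ((k : EReal) - 1) := by
      refine le_iInf₂ fun k hk => ?_
      have hk' : n + 2 ≤ k := by
        by_contra hcon
        exact hn (hP k (n + 1) (by omega) hk)
      obtain ⟨m, rfl⟩ : ∃ m, k = m + 1 := ⟨k - 1, by omega⟩
      rw [hsub]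
      exact_mod_cast (by omega : n + 1 ≤ m)
    have h2 := h1.trans h
    have h3 : n + 1 ≤ n := by exact_mod_cast h2
    omega
  · intro h
    exact (iInf₂_le (n + 1) h).trans (hsub n).le

/-- Enlarging each `U` by the uncovered bounded set `B` gives a coarse cover. Its open extensions
are refined in `Y`, and `B` is removed from the traces. -/
lemma CoveringDimLT.coarseDimLT {e : X → Y} (he : IsHigsonCompactification e) {δ : ℝ}
    (hδ : 0 < δ) (hX : IsDisjointSpace X δ) {k : ℕ} (h : CoveringDimLT Y k) :
    CoarseDimLT X k := by
  intro 𝒰 hfin hcoarse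
  -- An empty family has no member to absorb `B`, but it refines itself.
  rcases 𝒰.eq_empty_or_nonempty with rfl | ⟨U₀, hU₀⟩
  · exact ⟨∅, hcoarse, fun V hV => hV.elim, by simp [familyMultiplicity]⟩
  have hcoarse' := (isCoarseFamily_iff_ball_subset _).1 hcoarse
  set B : Set X := (⋃₀ 𝒰)ᶜ with hB
  have hBb : IsBounded B := by
    rw [isBounded_def, hB, compl_compl]
    filter_upwards [hcoarse' 1 one_pos] with x hx
    obtain ⟨U, hU, hxU⟩ := hx
    exact ⟨U, hU, hxU (Metric.mem_ball_self one_pos)⟩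
  have := hfin.to_subtype
  have hcov := he.iUnion_openExtension hδ hX (W := fun U : 𝒰 => U.1 ∪ B) (by
    rw [isCoarseFamily_iff_ball_subset]
    intro M hM
    filter_upwards [hcoarse' M hM] with x hx
    obtain ⟨U, hU, hxU⟩ := hx
    exact ⟨_, ⟨⟨U, hU⟩, rfl⟩, hxU.trans subset_union_left⟩) (by
    refine eq_univ_of_forall fun x => mem_iUnion.2 ?_
    by_cases hx : x ∈ B
    · exact ⟨⟨U₀, hU₀⟩, Or.inr hx⟩
    · obtain ⟨U, hU, hxU⟩ := not_not.1 hx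
      exact ⟨⟨U, hU⟩, Or.inl hxU⟩)
  obtain ⟨𝒱, hVfin, hVo, hVcov, hVref, hVmul⟩ := h _
    (finite_range fun U : 𝒰 => openExtension e (U.1 ∪ B))
    (by rintro _ ⟨U, rfl⟩; exact isOpen_openExtension e _)
    (by rw [sUnion_range, hcov])
  have := hVfin.to_subtype
  have hVc := (isCoarseFamily_iff_ball_subset _).1 (he.isCoarseFamily_preimage
    (U := fun V : 𝒱 => V.1) (fun V => hVo _ V.2) (by rw [← sUnion_eq_iUnion, hVcov]))
  refine ⟨range fun V : 𝒱 => e ⁻¹' V.1 \ B, ?_, ?_, familyMultiplicity_range_le fun x => ?_⟩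
  · rw [isCoarseFamily_iff_ball_subset]
    intro M hM
    filter_upwards [hVc M hM, eventually_disjoint_ball hBb M] with x hx hxB
    obtain ⟨_, ⟨V, rfl⟩, hxV⟩ := hx
    exact ⟨_, ⟨V, rfl⟩, subset_sdiff.2 ⟨hxV, hxB⟩⟩
  · rintro _ ⟨V, rfl⟩
    obtain ⟨_, ⟨U, rfl⟩, hVU⟩ := hVref V.1 V.2
    refine ⟨U.1, U.2, fun x hx => ?_⟩
    exact (preimage_openExtension_subset e _ (hVU hx.1)).resolve_right hx.2
  · refine le_trans ?_ ((le_iSup _ (e x)).trans hVmul)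
    rw [← Subtype.val_injective.encard_image]
    refine encard_le_encard ?_
    rintro _ ⟨V, hV, rfl⟩
    exact ⟨V.2, hV.1⟩

/-- A coarse refinement of the traces of a shrinking `K` is made into a cover of `X` and extended.
The shrinking is needed because an extension is controlled only by a closure. -/
lemma CoarseDimLT.coveringDimLT {e : X → Y} (he : IsHigsonCompactification e) {δ : ℝ}
    (hδ : 0 < δ) (hX : IsDisjointSpace X δ) {k : ℕ} (hk : 1 ≤ k) (h : CoarseDimLT X k) :
    CoveringDimLT Y k := by
  intro 𝒰 hfin ho hUcov
  have := he.compactSpace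
  have := he.t2Space
  have hdense : DenseRange e := he.isDenseEmbedding.dense
  have := hfin.to_subtype
  obtain ⟨K, hKcov, hKo, hKU⟩ := exists_iUnion_eq_closure_subset (u := fun U : 𝒰 => U.1)
    (fun U => ho _ U.2) (fun _ => Set.toFinite _) (by rw [← sUnion_eq_iUnion, hUcov])
  obtain ⟨𝒱, hVc, hVref, hVmul⟩ := h _ (finite_range fun i => e ⁻¹' K i)
    (he.isCoarseFamily_preimage hKo hKcov)
  have hVc := (isCoarseFamily_iff_ball_subset _).1 hVc
  have hc : ∀ V : 𝒱, ∃ i, V.1 ⊆ e ⁻¹' K i := fun V => by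
    obtain ⟨_, ⟨i, rfl⟩, hi⟩ := hVref V.1 V.2
    exact ⟨i, hi⟩
  choose c hc using hc
  have ha : ∀ x, ∃ i, e x ∈ K i := fun x => mem_iUnion.1 (hKcov.symm ▸ mem_univ (e x))
  choose a ha using ha
  set B : Set X := (⋃₀ 𝒱)ᶜ with hB
  have hBb : IsBounded B := by
    rw [isBounded_def, hB, compl_compl]
    filter_upwards [hVc 1 one_pos] with x hx
    obtain ⟨V, hV, hxV⟩ := hx
    exact ⟨V, hV, hxV (Metric.mem_ball_self one_pos)⟩
  -- `𝒱` may be infinite, so its members are merged according to a chosen `K i` containing them.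
  -- Each point of `B` goes into exactly one `W i`, which is where `1 ≤ k` enters.
  set W : 𝒰 → Set X := fun i => {x | ∃ V, c V = i ∧ x ∈ V.1} ∪ {x | x ∈ B ∧ a x = i} with hW
  have hWK : ∀ i, W i ⊆ e ⁻¹' K i := by
    rintro i x (⟨V, rfl, hx⟩ | ⟨-, rfl⟩)
    · exact hc V hx
    · exact ha x
  have hWcov : ⋃ i, W i = univ := by
    refine eq_univ_of_forall fun x => mem_iUnion.2 ?_
    by_cases hx : x ∈ B
    · exact ⟨a x, Or.inr ⟨hx, rfl⟩⟩
    · obtain ⟨V, hV, hxV⟩ := not_not.1 hx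
      exact ⟨c ⟨V, hV⟩, Or.inl ⟨⟨V, hV⟩, rfl, hxV⟩⟩
  have hWc : IsCoarseFamily (range W) := by
    rw [isCoarseFamily_iff_ball_subset]
    intro M hM
    filter_upwards [hVc M hM] with x hx
    obtain ⟨V, hV, hxV⟩ := hx
    exact ⟨_, ⟨c ⟨V, hV⟩, rfl⟩, fun y hy => Or.inl ⟨⟨V, hV⟩, rfl, hxV hy⟩⟩
  have hWmul : ∀ x, {i | x ∈ W i}.encard ≤ k := by
    intro x
    by_cases hx : x ∈ B
    · refine (encard_le_encard (t := {a x}) ?_).trans ?_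
      · rintro i (⟨V, -, hxV⟩ | ⟨-, rfl⟩)
        · exact (hx ⟨V.1, V.2, hxV⟩).elim
        · rfl
      · rw [encard_singleton]
        exact_mod_cast hk
    · refine le_trans ?_ ((le_iSup _ x).trans hVmul)
      refine (encard_le_encard (t := c '' {V | x ∈ V.1}) ?_).trans
        ((encard_image_le _ _).trans ?_)
      · rintro i (⟨V, rfl, hxV⟩ | ⟨hxB, -⟩)
        · exact ⟨V, hxV, rfl⟩
        · exact (hx hxB).elim
      · rw [← Subtype.val_injective.encard_image]
        refine encard_le_encard ?_
        rintro _ ⟨V, hV, rfl⟩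
        exact ⟨V.2, hV⟩
  refine ⟨range fun i => openExtension e (W i), finite_range _, ?_, ?_, ?_,
    familyMultiplicity_range_le (encard_mem_openExtension_le hdense hWmul)⟩
  · rintro _ ⟨i, rfl⟩
    exact isOpen_openExtension e _
  · rw [sUnion_range, he.iUnion_openExtension hδ hX hWc hWcov]
  · rintro _ ⟨i, rfl⟩
    refine ⟨i.1, i.2, (openExtension_subset_closure hdense _).trans ?_⟩
    exact (closure_mono (image_subset_iff.2 (hWK i))).trans (hKU i)

/-- Multiplicity 0 means that no point is covered, while a coarse refinement of `{univ}` covers all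
points outside a bounded set. -/
lemma CoarseDimLT.isBounded_univ (h : CoarseDimLT X 0) : IsBounded (univ : Set X) := by
  obtain ⟨𝒱, hVc, -, hVmul⟩ := h {univ} (finite_singleton _)
    ((isCoarseFamily_iff_ball_subset _).2 fun M _ => Eventually.of_forall fun x =>
      ⟨univ, rfl, subset_univ _⟩)
  rw [isBounded_def, compl_univ]
  filter_upwards [(isCoarseFamily_iff_ball_subset _).1 hVc 1 one_pos] with x hx
  obtain ⟨V, hV, hxV⟩ := hx
  have h1 : {U ∈ 𝒱 | x ∈ U}.encard ≤ 0 := (le_iSup _ x).trans hVmul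
  rw [nonpos_iff_eq_zero, encard_eq_zero] at h1
  exact h1.subset ⟨hV, hxV (Metric.mem_ball_self one_pos)⟩

end

end CoarseGeometry

open CoarseGeometry in
theorem mainTheorem6 {X : Type*} [MetricSpace X] {Y : Type*} [TopologicalSpace Y]
    (e : X → Y) (he : CoarseGeometry.IsHigsonCompactification e)
    (δ : ℝ) (hδ : 0 < δ) (hX : CoarseGeometry.IsDisjointSpace X δ) :
    ((IsEmpty X ∨ ¬ Bornology.IsBounded (Set.univ : Set X)) →
      CoarseGeometry.coarseDim X = CoarseGeometry.coveringDim Y) ∧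
    ∀ n : ℕ, CoarseGeometry.coarseDim X ≤ (n : EReal) ↔
      CoarseGeometry.coveringDim Y ≤ (n : EReal) := by
  have hiff : ∀ k, 1 ≤ k → (CoarseDimLT X k ↔ CoveringDimLT Y k) := fun k hk =>
    ⟨fun h => h.coveringDimLT he hδ hX hk, fun h => h.coarseDimLT he hδ hX⟩
  constructor
  · intro hcase
    have hall : ∀ k, CoarseDimLT X k ↔ CoveringDimLT Y k := by
      intro k
      rcases Nat.eq_zero_or_pos k with rfl | hk
      -- For `k = 0` the coarse side makes `X` bounded, so the case assumption leaves only empty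
      -- `X`, and then `Y` is empty by density.
      · refine ⟨fun h => ?_, fun h => h.coarseDimLT he hδ hX⟩
        have hempty : IsEmpty X := hcase.resolve_right (not_not.2 h.isBounded_univ)
        have hY : IsEmpty Y := by
          rw [← not_nonempty_iff, ← he.isDenseEmbedding.dense.nonempty_iff]
          exact not_nonempty_iff.2 hempty
        exact fun 𝒰 _ _ _ => ⟨∅, Set.finite_empty, fun V hV => hV.elim,
          Subsingleton.elim _ _, fun V hV => hV.elim, by simp [familyMultiplicity]⟩
      · exact hiff k hk
    exact iInf_congr fun k => iInf_congr_Prop (hall k) fun _ => rfl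
  · intro n
    exact (iInf_natCast_sub_one_le_iff (P := CoarseDimLT X)
      (fun _ _ hkl h => h.mono hkl) n).trans ((hiff (n + 1) (by omega)).trans
      (iInf_natCast_sub_one_le_iff (P := CoveringDimLT Y)
        (fun _ _ hkl h => h.mono hkl) n).symm)
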